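/- Let $n\ge 1$ and let $X=(X_1,\dots,X_n)\sim\mathcal N(0,C)$ be a (possibly degenerate) centred Gaussian random vector in $\mathbb R^n$ with covariance matrix $C$ such that $C_{ii}=1$ for all $i$. Let $\ell:\mathbb R\to\mathbb R$ be a continuously differentiable function whose derivative $\ell'$ is supported in $[-\tfrac12,\tfrac12]$. Let $\Phi$ be the cumulative distribution function of the standard Gaussian distribution, and for $t\in\mathbb R$ put $$\widehat Q_n(t)=\frac1n\sum_{i=1}^n \ell\bigl(t-\Phi(X_i)\bigr).$$ Let $\Delta=\sum_{i\ne j}|C_{ij}|$, the sum being over ordered pairs $(i,j)$ with $i \neq j$, and $$D(\ell)=\sqrt{\int_{-1}^{2}\left[\int_0^1 \bigl(\ell'(t-y)\bigr)^2\,dy-\left(\int_0^1 \ell'(t-y)\,dy\right)^2\right]dt}.$$ Then $\widehat Q_n(t)$ is integrable for every $t$, the random variable $\sup_{t\in\mathbb R}|\widehat Q_n(t)-\mathbf E\widehat Q_n(t)|$ is finite and integrable, and $$\mathbf E\sup_{t\in\mathbb R}\bigl|\widehat Q_n(t)-\mathbf E\widehat Q_n(t)\bigr|\le(\sqrt6+\sqrt3)\,D(\ell)\,\sqrt{\frac{n+\Delta}{n^2}}.$$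 -/

import Mathlib

open MeasureTheory ProbabilityTheory

noncomputable section

/-- The cumulative distribution function of the standard Gaussian distribution on `ℝ`. -/
def stdNormalCDF (x : ℝ) : ℝ := cdf (gaussianReal 0 1) x

/-- The smoothed empirical process `(1/n) ∑ ℓ(t - Φ(x_i))`, as a function of the sample `x`
and of the parameter `t`. -/
def smoothEmpirical {n : ℕ} (ℓ : ℝ → ℝ) (x : EuclideanSpace ℝ (Fin n)) (t : ℝ) : ℝ :=
  (1 / (n : ℝ)) * ∑ i, ℓ (t - stdNormalCDF (x i))

/-- The sum of the absolute values of the off-diagonal entries of a matrix. -/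
def offDiagAbsSum {n : ℕ} (C : Matrix (Fin n) (Fin n) ℝ) : ℝ :=
  ∑ p ∈ (Finset.univ : Finset (Fin n)).offDiag, |C p.1 p.2|

/-- The functional `D(ℓ)`. -/
def smoothingFunctional (ℓ : ℝ → ℝ) : ℝ :=
  √(∫ t in (-1 : ℝ)..2,
      ((∫ y in (0 : ℝ)..1, (deriv ℓ (t - y)) ^ 2) - (∫ y in (0 : ℝ)..1, deriv ℓ (t - y)) ^ 2))

end

/-! Since `deriv ℓ` has compact support, the centred process is the primitive of its own centred
derivative W, which vanishes for s outside (-1, 2]. Hence the supremum over t is at most the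
integral of |W| over (-1, 2], and no chaining is needed. Cauchy-Schwarz on the product of the
Gaussian law with an interval of length 3 reduces the claim to the pointwise variance of W, and
gives √3 alone as constant; the √6 is slack.

The variance of an average of n terms f(X_i) is a sum of covariances. Gebelein's inequality
(`abs_integral_comp_mul_comp_sub_le`) bounds the (i, j) covariance by |C i j| Var f, so the sum is
at most (n + Δ) Var f. As Φ(X_i) is uniform (`measurePreserving_cdf_of_nullSingletonClass`),
integrating Var f over the parameter produces D(ℓ)².

Gebelein's inequality is tested on linear combinations of exponentials, where it becomes a
comparison of power series (`abs_sum_exp_kernel_le`), and extended by density in L²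
(`topologicalClosure_span_expLp`). Only the joint moment generating function is used, so degenerate
pairs with |ρ| = 1 need no separate treatment. -/

/-! ### Exponentials in Gaussian L² and Gebelein's inequality. -/

/-- The exponential kernel `exp (ρ a b) - 1` is dominated by `|ρ|` times the kernel
`exp (a b) - 1`, as quadratic forms. -/
theorem abs_sum_exp_kernel_le (s : Finset ℝ) (d : ℝ → ℝ) {ρ : ℝ} (hρ : |ρ| ≤ 1) :
    |∑ a ∈ s, ∑ b ∈ s, d a * d b * (Real.exp (ρ * (a * b)) - 1)| ≤
      |ρ| * ∑ a ∈ s, ∑ b ∈ s, d a * d b * (Real.exp (a * b) - 1) := by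
  -- Each order of the exponential series is r ^ (m + 1) times a nonnegative square. Removing the
  -- constant term leaves at least one factor r everywhere, which is where the gain |ρ| comes from.
  have expand (r : ℝ) : HasSum
      (fun m : ℕ => r ^ (m + 1) * ((∑ a ∈ s, d a * a ^ (m + 1)) ^ 2 / (m + 1).factorial))
      (∑ a ∈ s, ∑ b ∈ s, d a * d b * (Real.exp (r * (a * b)) - 1)) := by
    have h1 (x : ℝ) : HasSum (fun m : ℕ => x ^ (m + 1) / (m + 1).factorial) (Real.exp x - 1) := by
      have h := NormedSpace.expSeries_div_hasSum_exp (𝔸 := ℝ) x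
      rw [← Real.exp_eq_exp_ℝ, ← hasSum_nat_add_iff' 1] at h
      simpa using h
    have h2 := hasSum_sum fun a (_ : a ∈ s) => hasSum_sum fun b (_ : b ∈ s) =>
      (h1 (r * (a * b))).mul_left (d a * d b)
    refine h2.congr_fun ?_
    intro m
    rw [sq, Finset.sum_mul_sum, Finset.sum_div, Finset.mul_sum]
    refine Finset.sum_congr rfl fun a _ => ?_
    rw [Finset.sum_div, Finset.mul_sum]
    refine Finset.sum_congr rfl fun b _ => ?_
    ring
  have hs := (expand 1).mul_left |ρ|
  have hb := expand ρ
  simp only [one_mul, one_pow] at hs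
  have hbound (m : ℕ) : ‖ρ ^ (m + 1) * ((∑ a ∈ s, d a * a ^ (m + 1)) ^ 2 / (m + 1).factorial)‖ ≤
      |ρ| * ((∑ a ∈ s, d a * a ^ (m + 1)) ^ 2 / (m + 1).factorial) := by
    rw [norm_mul, Real.norm_eq_abs, Real.norm_eq_abs, abs_of_nonneg (a := _ / _) (by positivity),
      abs_pow, pow_succ]
    gcongr
    exact mul_le_of_le_one_left (abs_nonneg _) (pow_le_one₀ (abs_nonneg _) hρ)
  rw [← hb.tsum_eq, ← Real.norm_eq_abs]
  exact tsum_of_norm_bounded hs hbound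

theorem memLp_two_exp_mul_gaussianReal (a : ℝ) :
    MemLp (fun x => Real.exp (a * x)) 2 (gaussianReal 0 1) := by
  rw [memLp_two_iff_integrable_sq (by fun_prop)]
  refine (integrable_exp_mul_gaussianReal (2 * a)).congr (ae_of_all _ fun x => ?_)
  simp only [sq, ← Real.exp_add]
  ring_nf

/-- The exponential `x ↦ exp (a x)` as a square integrable function. -/
noncomputable def expLp (a : ℝ) : Lp ℝ 2 (gaussianReal 0 1) :=
  (memLp_two_exp_mul_gaussianReal a).toLp _

/-- Finite measures on the line with everywhere finite, equal moment generating functions agree. -/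
theorem eq_of_mgf_id_eq {μ ν : Measure ℝ} [IsFiniteMeasure μ] [IsFiniteMeasure ν]
    (hμ : integrableExpSet id μ = Set.univ) (h : mgf id μ = mgf id ν) : μ = ν := by
  have h0 : μ = 0 ↔ ν = 0 := by
    have := congrFun h 0
    simp only [mgf_zero', measureReal_def] at this
    rw [← Measure.measure_univ_eq_zero, ← Measure.measure_univ_eq_zero (μ := ν)]
    rw [ENNReal.toReal_eq_toReal_iff' (measure_ne_top _ _) (measure_ne_top _ _)] at this
    rw [this]
  -- Finiteness everywhere makes the strip of analyticity all of ℂ, so equality on the real line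
  -- continues to equality of the complex transforms.
  refine Measure.ext_of_complexMGF_id_eq (funext fun z => ?_)
  exact eqOn_complexMGF_of_mgf' h h0 (by simp [hμ])

/-- An integrable density whose Laplace transform vanishes identically is zero. -/
theorem ae_eq_zero_of_integral_exp_mul_eq_zero {γ : Measure ℝ}
    {g : ℝ → ℝ} (hg : ∀ a : ℝ, Integrable (fun x => Real.exp (a * x) * g x) γ)
    (h : ∀ a : ℝ, ∫ x, Real.exp (a * x) * g x ∂γ = 0) : g =ᵐ[γ] 0 := by
  have hg0 : Integrable g γ := by simpa using hg 0
  have hm := hg0.aestronglyMeasurable.aemeasurable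
  have key (f : ℝ → ℝ) (hf : AEMeasurable f γ) (hfg : ∀ x, |f x| = |g x|) (a : ℝ) :
      Integrable (fun x => Real.exp (a * x)) (γ.withDensity fun x => ENNReal.ofReal (f x)) ∧
      ∫ x, Real.exp (a * x) ∂(γ.withDensity fun x => ENNReal.ofReal (f x)) =
        ∫ x, Real.exp (a * x) * max (f x) 0 ∂γ ∧
      Integrable (fun x => Real.exp (a * x) * max (f x) 0) γ := by
    have hi : Integrable (fun x => Real.exp (a * x) * max (f x) 0) γ := by
      refine (hg a).mono (by fun_prop) (ae_of_all _ fun x => ?_)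
      rw [norm_mul, norm_mul]
      gcongr
      rw [Real.norm_eq_abs, Real.norm_eq_abs, ← hfg, abs_of_nonneg (le_max_right _ _)]
      exact max_le (le_abs_self _) (abs_nonneg _)
    refine ⟨?_, ?_, hi⟩
    · rw [integrable_withDensity_iff_integrable_smul₀' hf.ennreal_ofReal (by simp)]
      refine hi.congr (ae_of_all _ fun x => ?_)
      simp [ENNReal.toReal_ofReal', mul_comm]
    · rw [integral_withDensity_eq_integral_toReal_smul₀ hf.ennreal_ofReal (by simp)]
      refine integral_congr_ae (ae_of_all _ fun x => ?_)
      simp [ENNReal.toReal_ofReal', mul_comm]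
  have kp := key g hm (fun _ => rfl)
  have kn := key (fun x => -g x) hm.neg (fun _ => abs_neg _)
  have := isFiniteMeasure_withDensity_ofReal hg0.2
  have : IsFiniteMeasure (γ.withDensity fun x => ENNReal.ofReal (-g x)) :=
    isFiniteMeasure_withDensity_ofReal hg0.neg.2
  -- The positive and negative parts of g are densities of finite measures, and the hypothesis says
  -- that their moment generating functions agree.
  have hEq : (γ.withDensity fun x => ENNReal.ofReal (g x)) =
      γ.withDensity fun x => ENNReal.ofReal (-g x) := by
    refine eq_of_mgf_id_eq ?_ (funext fun a => ?_)
    · ext a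
      simpa [integrableExpSet] using (kp a).1
    · simp only [mgf, id]
      rw [(kp a).2.1, (kn a).2.1, ← sub_eq_zero, ← integral_sub (kp a).2.2 (kn a).2.2]
      refine Eq.trans (integral_congr_ae (ae_of_all _ fun x => ?_)) (h a)
      dsimp only
      rw [← mul_sub]
      rcases le_total (g x) 0 with h | h <;> simp [h]
  have hae := (withDensity_eq_iff hm.ennreal_ofReal hm.neg.ennreal_ofReal ?_).1 hEq
  · filter_upwards [hae] with x hx
    simp only [Pi.neg_apply] at hx
    rcases le_total (g x) 0 with h | h
    · rw [ENNReal.ofReal_of_nonpos h, eq_comm, ENNReal.ofReal_eq_zero] at hx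
      simp only [Pi.zero_apply]; linarith
    · rw [ENNReal.ofReal_of_nonpos (p := -g x) (by linarith), ENNReal.ofReal_eq_zero] at hx
      simp only [Pi.zero_apply]; linarith
  · exact hg0.lintegral_lt_top.ne

/-- The exponentials span a dense subspace of the square integrable functions of a Gaussian. -/
theorem topologicalClosure_span_expLp :
    (Submodule.span ℝ (Set.range expLp)).topologicalClosure = ⊤ := by
  rw [Submodule.topologicalClosure_eq_top_iff, Submodule.eq_bot_iff]
  intro g hg
  rw [Submodule.mem_orthogonal] at hg
  rw [Lp.eq_zero_iff_ae_eq_zero]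
  have h1 (a : ℝ) : (fun x => inner ℝ (expLp a x) (g x)) =ᵐ[gaussianReal 0 1]
      fun x => Real.exp (a * x) * g x := by
    filter_upwards [(memLp_two_exp_mul_gaussianReal a).coeFn_toLp] with x hx
    simp [expLp, hx, mul_comm]
  refine ae_eq_zero_of_integral_exp_mul_eq_zero (fun a => ?_) (fun a => ?_)
  · exact (L2.integrable_inner (𝕜 := ℝ) (expLp a) g).congr (h1 a)
  · rw [← integral_congr_ae (h1 a), ← L2.inner_def]
    exact hg _ (Submodule.subset_span ⟨a, rfl⟩)

/-- Gebelein's inequality: square integrable functions of two standard Gaussian variables with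
correlation `ρ` have covariance at most `|ρ|` times the variance. -/
theorem abs_integral_comp_mul_comp_sub_le {E : Type*} [MeasurableSpace E] {μ : Measure E}
    {Y Z : E → ℝ} {ρ : ℝ} (hρ : |ρ| ≤ 1)
    (hY : MeasurePreserving Y μ (gaussianReal 0 1)) (hZ : MeasurePreserving Z μ (gaussianReal 0 1))
    (hYZ : ∀ a b : ℝ, ∫ x, Real.exp (a * Y x + b * Z x) ∂μ =
      Real.exp ((a ^ 2 + b ^ 2) / 2 + ρ * (a * b)))
    {f : ℝ → ℝ} (hf : MemLp f 2 (gaussianReal 0 1)) :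
    |∫ x, f (Y x) * f (Z x) ∂μ - (∫ x, f x ∂gaussianReal 0 1) ^ 2| ≤
      |ρ| * (∫ x, f x ^ 2 ∂gaussianReal 0 1 - (∫ x, f x ∂gaussianReal 0 1) ^ 2) := by
  set A := Lp.compMeasurePreservingₗᵢ ℝ (E := ℝ) (p := 2) Y hY with hA
  set B := Lp.compMeasurePreservingₗᵢ ℝ (E := ℝ) (p := 2) Z hZ with hB
  have innerAB {u v : ℝ → ℝ} (hu : MemLp u 2 (gaussianReal 0 1))
      (hv : MemLp v 2 (gaussianReal 0 1)) :
      inner ℝ (A (hu.toLp u)) (B (hv.toLp v)) = ∫ x, u (Y x) * v (Z x) ∂μ := by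
    rw [L2.inner_def]
    refine integral_congr_ae ?_
    have e1 : A (hu.toLp u) = _ := Lp.toLp_compMeasurePreserving hu hY
    have e2 : B (hv.toLp v) = _ := Lp.toLp_compMeasurePreserving hv hZ
    rw [e1, e2]
    filter_upwards [(hu.comp_measurePreserving hY).coeFn_toLp,
      (hv.comp_measurePreserving hZ).coeFn_toLp] with x h1 h2
    rw [h1, h2]
    simp [mul_comm]
  have inner' {u v : ℝ → ℝ} (hu : MemLp u 2 (gaussianReal 0 1))
      (hv : MemLp v 2 (gaussianReal 0 1)) :
      inner ℝ (hu.toLp u) (hv.toLp v) = ∫ x, u x * v x ∂gaussianReal 0 1 := by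
    rw [L2.inner_def]
    refine integral_congr_ae ?_
    filter_upwards [hu.coeFn_toLp, hv.coeFn_toLp] with x h1 h2
    rw [h1, h2]
    simp [mul_comm]
  have hexp (a b : ℝ) : inner ℝ (expLp a) (expLp b) = Real.exp ((a ^ 2 + b ^ 2) / 2 + a * b) := by
    rw [expLp, expLp, inner']
    have := congrFun (mgf_id_gaussianReal (μ := 0) (v := 1)) (a + b)
    simp only [mgf, id, add_mul, Real.exp_add] at this
    rw [this]
    simp
    ring_nf
  have hexpAB (a b : ℝ) : inner ℝ (A (expLp a)) (B (expLp b)) =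
      Real.exp ((a ^ 2 + b ^ 2) / 2 + ρ * (a * b)) := by
    rw [expLp, expLp, innerAB, ← hYZ]
    simp only [Real.exp_add]
  have main (u : Lp ℝ 2 (gaussianReal 0 1)) :
      |inner ℝ (A u) (B u) - inner ℝ (expLp 0) u ^ 2| ≤
        |ρ| * (inner ℝ u u - inner ℝ (expLp 0) u ^ 2) := by
    have hu : u ∈ (Submodule.span ℝ (Set.range expLp)).topologicalClosure := by
      rw [topologicalClosure_span_expLp]; trivial
    have hclosed : IsClosed {u : Lp ℝ 2 (gaussianReal 0 1) |
        |inner ℝ (A u) (B u) - inner ℝ (expLp 0) u ^ 2| ≤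
        |ρ| * (inner ℝ u u - inner ℝ (expLp 0) u ^ 2)} := by
      have := A.continuous
      have := B.continuous
      exact isClosed_le (by fun_prop) (by fun_prop)
    -- Both sides are continuous in u, so finite combinations of exponentials suffice.
    refine closure_minimal (fun u hu => ?_) hclosed hu
    obtain ⟨c, rfl⟩ := (Finsupp.mem_span_range_iff_exists_finsupp).1 hu
    -- The weight exp (a² / 2) is the mean of exp (a x). Once it is factored out, subtracting the
    -- squared mean turns exp (r a b) into exp (r a b) - 1, with r = ρ for the covariance and r = 1
    -- for the variance.
    have key := abs_sum_exp_kernel_le c.support (fun a => c a * Real.exp (a ^ 2 / 2)) hρ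
    have split (r : ℝ) : ∑ a ∈ c.support, ∑ b ∈ c.support,
        c a * (c b * Real.exp ((b ^ 2 + a ^ 2) / 2 + r * (b * a))) -
        (∑ b ∈ c.support, c b * Real.exp (b ^ 2 / 2)) ^ 2 =
        ∑ a ∈ c.support, ∑ b ∈ c.support, c a * Real.exp (a ^ 2 / 2) *
          (c b * Real.exp (b ^ 2 / 2)) * (Real.exp (r * (a * b)) - 1) := by
      rw [sq, Finset.sum_mul_sum, ← Finset.sum_sub_distrib]
      refine Finset.sum_congr rfl fun a _ => ?_
      rw [← Finset.sum_sub_distrib]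
      refine Finset.sum_congr rfl fun b _ => ?_
      rw [add_div, Real.exp_add, Real.exp_add, mul_comm b a]
      ring
    have s1 := split 1
    simp only [one_mul] at s1
    rw [← split ρ, ← s1] at key
    simpa [Finsupp.sum, map_sum, sum_inner, inner_sum, inner_smul_left, inner_smul_right,
      hexp, hexpAB, Finset.mul_sum, -inner_self_eq_norm_sq_to_K] using key
  have := main (hf.toLp f)
  have h0 : inner ℝ (expLp 0) (hf.toLp f) = ∫ x, f x ∂gaussianReal 0 1 := by
    rw [expLp, inner']
    simp
  rw [h0, innerAB, inner'] at this
  simpa only [sq] using this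

/-! ### The probability integral transform. -/

open Set Filter Topology in
/-- The distribution function of a measure without atoms is continuous. -/
theorem continuous_cdf_of_nullSingletonClass (μ : Measure ℝ) [IsProbabilityMeasure μ] [NullSingletonClass μ] :
    Continuous (cdf μ) := by
  refine continuous_iff_continuousAt.2 fun x => ?_
  rw [(monotone_cdf μ).continuousAt_iff_leftLim_eq_rightLim, StieltjesFunction.rightLim_eq]
  have h := (cdf μ).measure_singleton x
  rw [measure_cdf, measure_singleton, eq_comm, ENNReal.ofReal_eq_zero] at h
  exact le_antisymm ((monotone_cdf μ).leftLim_le le_rfl) (by linarith)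

open Set Filter Topology in
/-- The probability integral transform: the distribution function of a measure without atoms
maps it to the uniform distribution on the unit interval. -/
theorem measurePreserving_cdf_of_nullSingletonClass (μ : Measure ℝ) [IsProbabilityMeasure μ]
    [NullSingletonClass μ] : MeasurePreserving (cdf μ) μ (volume.restrict (Icc 0 1)) := by
  have hc := continuous_cdf_of_nullSingletonClass μ
  refine ⟨hc.measurable, ?_⟩
  have : IsProbabilityMeasure (μ.map (cdf μ)) :=
    Measure.isProbabilityMeasure_map hc.measurable.aemeasurable
  have : IsProbabilityMeasure (volume.restrict (Icc (0 : ℝ) 1)) := ⟨by simp⟩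
  have hex {x : ℝ} (h0 : 0 < x) (h1 : x < 1) : ∃ a, cdf μ a = x :=
    mem_range_of_exists_le_of_exists_ge hc
      (((tendsto_cdf_atBot μ).eventually_lt_const h0).exists.imp fun _ h => h.le)
      (((tendsto_cdf_atTop μ).eventually_const_lt h1).exists.imp fun _ h => h.le)
  refine Measure.eq_of_cdf _ _ (StieltjesFunction.ext fun x => ?_)
  rw [cdf_eq_real, cdf_eq_real, measureReal_restrict_apply measurableSet_Iic,
    map_measureReal_apply hc.measurable measurableSet_Iic]
  rcases lt_or_ge x 0 with hx0 | hx0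
  · have e1 : cdf μ ⁻¹' Iic x = ∅ := by
      ext y
      simpa using hx0.trans_le (cdf_nonneg μ y)
    have e2 : Iic x ∩ Icc 0 1 = ∅ := by
      ext y
      simp only [mem_inter_iff, mem_Iic, mem_Icc, mem_empty_iff_false, iff_false]
      intro h; linarith [h.1, h.2.1]
    simp [e1, e2]
  rcases le_or_gt 1 x with hx1 | hx1
  · have e1 : cdf μ ⁻¹' Iic x = univ := by
      ext y
      simpa using (cdf_le_one μ y).trans hx1
    have e2 : Iic x ∩ Icc 0 1 = Icc 0 1 :=
      inter_eq_right.2 fun y hy => hy.2.trans hx1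
    simp [e1, e2]
  have e2 : Iic x ∩ Icc 0 1 = Icc 0 x := by
    ext y
    simp only [mem_inter_iff, mem_Iic, mem_Icc]
    constructor
    · rintro ⟨h1, h2, h3⟩; exact ⟨h2, h1⟩
    · rintro ⟨h1, h2⟩; exact ⟨h2, h1, h2.trans hx1.le⟩
  rw [e2, Real.volume_real_Icc_of_le hx0, sub_zero]
  -- The distribution function may be flat at level x, so a preimage of x need not bound the
  -- sublevel set; the upper bound goes through preimages of levels r > x.
  refine le_antisymm (le_of_forall_gt_imp_ge_of_dense fun r hr => ?_) ?_
  · rcases le_or_gt 1 r with hr1 | hr1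
    · exact measureReal_le_one.trans hr1
    obtain ⟨a, rfl⟩ := hex (hx0.trans_lt hr) hr1
    rw [cdf_eq_real μ a]
    refine measureReal_mono fun y hy => ?_
    exact (((monotone_cdf μ).reflect_lt ((mem_Iic.1 hy).trans_lt hr))).le
  · rcases hx0.eq_or_lt with rfl | hx0
    · exact measureReal_nonneg
    obtain ⟨a, rfl⟩ := hex hx0 hx1
    exact (cdf_eq_real μ a).trans_le (measureReal_mono fun y hy => monotone_cdf μ hy)

/-! ### Coordinates of a Gaussian vector. -/

/-- A positive semidefinite matrix with unit diagonal has entries of absolute value at most one. -/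
theorem Matrix.PosSemidef.abs_apply_le_one {n : ℕ} {C : Matrix (Fin n) (Fin n) ℝ}
    (hC : C.PosSemidef) (hdiag : ∀ i, C i i = 1) (i j : Fin n) : |C i j| ≤ 1 := by
  have key (a : ℝ) := hC.dotProduct_mulVec_nonneg (Pi.single i 1 + Pi.single j a)
  have hsymm : C j i = C i j := by simpa using hC.isHermitian.apply i j
  have h1 := key 1
  have h2 := key (-1)
  simp [Matrix.mulVec_add, add_dotProduct, dotProduct_add, hdiag, hsymm] at h1 h2
  rw [abs_le]
  constructor <;> linarith

/-- The moment generating function of a pair of standardised Gaussian coordinates. -/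
theorem integral_exp_add_multivariateGaussian {n : ℕ} {C : Matrix (Fin n) (Fin n) ℝ}
    (hC : C.PosSemidef) (hdiag : ∀ i, C i i = 1) (i j : Fin n) (a b : ℝ) :
    ∫ x, Real.exp (a * x i + b * x j) ∂multivariateGaussian 0 C =
      Real.exp ((a ^ 2 + b ^ 2) / 2 + C i j * (a * b)) := by
  set μ := multivariateGaussian 0 C
  let L : StrongDual ℝ (EuclideanSpace ℝ (Fin n)) :=
    a • EuclideanSpace.proj i + b • EuclideanSpace.proj j
  have hL (x) : L x = a * x i + b * x j := by simp [L]
  have h2 (k : Fin n) : MemLp (fun x : EuclideanSpace ℝ (Fin n) => x k) 2 μ := by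
    have := (IsGaussian.memLp_two_id (μ := μ)).continuousLinearMap_comp
      (EuclideanSpace.proj (𝕜 := ℝ) k)
    simpa using this
  have hmean : μ[L] = 0 := by
    rw [ContinuousLinearMap.integral_comp_id_comm IsGaussian.integrable_id]
    simp [μ]
  have hvar : Var[L; μ] = a ^ 2 + b ^ 2 + 2 * (C i j * (a * b)) := by
    have : (L : EuclideanSpace ℝ (Fin n) → ℝ) = fun x => a * x i + b * x j := funext hL
    rw [this, variance_fun_add ((h2 i).const_mul a) ((h2 j).const_mul b), variance_const_mul,
      variance_const_mul, covariance_const_mul_left, covariance_const_mul_right,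
      variance_eval_multivariateGaussian hC, variance_eval_multivariateGaussian hC,
      covariance_eval_multivariateGaussian hC, hdiag, hdiag]
    ring
  -- The joint transform at (a, b) is the one-dimensional transform of the Gaussian variable `L`,
  -- evaluated at 1.
  have h := mgf_gaussianReal (IsGaussian.map_eq_gaussianReal (μ := μ) L) 1
  simp only [mgf, one_mul, hL] at h
  rw [h, Real.coe_toNNReal _ (variance_nonneg _ _), hvar]
  simp only [← hL, hmean]
  ring_nf

/-- Coordinates of a Gaussian vector with unit variances are standard Gaussian. -/
theorem measurePreserving_eval_stdGaussianMarginal {n : ℕ} {C : Matrix (Fin n) (Fin n) ℝ}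
    (hC : C.PosSemidef) (hdiag : ∀ i, C i i = 1)
    (k : Fin n) : MeasurePreserving (fun x : EuclideanSpace ℝ (Fin n) => x k)
      (multivariateGaussian 0 C) (gaussianReal 0 1) := by
  simpa [hdiag] using measurePreserving_eval_multivariateGaussian (μ := 0) hC (i := k)

/-- Covariance bound for a function of two coordinates of a Gaussian vector with standard
marginals. -/
theorem abs_integral_eval_mul_eval_sub_le {n : ℕ} {C : Matrix (Fin n) (Fin n) ℝ}
    (hC : C.PosSemidef) (hdiag : ∀ i, C i i = 1) (i j : Fin n)
    {f : ℝ → ℝ} (hf : MemLp f 2 (gaussianReal 0 1)) :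
    |∫ x, f (x i) * f (x j) ∂multivariateGaussian 0 C - (∫ x, f x ∂gaussianReal 0 1) ^ 2| ≤
      |C i j| * (∫ x, f x ^ 2 ∂gaussianReal 0 1 - (∫ x, f x ∂gaussianReal 0 1) ^ 2) := by
  exact abs_integral_comp_mul_comp_sub_le (hC.abs_apply_le_one hdiag i j)
    (measurePreserving_eval_stdGaussianMarginal hC hdiag i)
    (measurePreserving_eval_stdGaussianMarginal hC hdiag j)
    (integral_exp_add_multivariateGaussian hC hdiag i j) hf

/-! ### The normal distribution function and the smoothed empirical process. -/

instance nullSingletonClass_gaussianReal_one : NullSingletonClass (gaussianReal 0 1) :=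
  nullSingletonClass_gaussianReal one_ne_zero

theorem continuous_stdNormalCDF : Continuous stdNormalCDF :=
  continuous_cdf_of_nullSingletonClass _

theorem stdNormalCDF_mem_Icc (x : ℝ) : stdNormalCDF x ∈ Set.Icc (0 : ℝ) 1 :=
  ⟨cdf_nonneg _ _, cdf_le_one _ _⟩

theorem integral_comp_stdNormalCDF {h : ℝ → ℝ} (hh : Continuous h) :
    ∫ x, h (stdNormalCDF x) ∂gaussianReal 0 1 = ∫ y in (0 : ℝ)..1, h y := by
  have hmp := measurePreserving_cdf_of_nullSingletonClass (gaussianReal 0 1)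
  rw [intervalIntegral.integral_of_le zero_le_one, ← integral_Icc_eq_integral_Ioc, ← hmp.map_eq,
    integral_map hmp.aemeasurable hh.aestronglyMeasurable]
  rfl

theorem continuous_intervalIntegral_sub {g : ℝ → ℝ} (hg : Continuous g) :
    Continuous fun t => ∫ y in (0 : ℝ)..1, g (t - y) :=
  intervalIntegral.continuous_parametric_intervalIntegral_of_continuous'
    (f := fun t y => g (t - y)) (by fun_prop) 0 1

theorem continuous_smoothEmpirical {n : ℕ} {g : ℝ → ℝ} (hg : Continuous g) :
    Continuous fun p : EuclideanSpace ℝ (Fin n) × ℝ => smoothEmpirical g p.1 p.2 := by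
  have := continuous_stdNormalCDF
  unfold smoothEmpirical
  fun_prop

theorem abs_smoothEmpirical_le {n : ℕ} {g : ℝ → ℝ} {K t : ℝ} (x : EuclideanSpace ℝ (Fin n))
    (hK : ∀ y ∈ Set.Icc (0 : ℝ) 1, |g (t - y)| ≤ K) (hK0 : 0 ≤ K) :
    |smoothEmpirical g x t| ≤ K := by
  unfold smoothEmpirical
  rw [abs_mul, abs_of_nonneg (by positivity : (0 : ℝ) ≤ 1 / n)]
  calc 1 / (n : ℝ) * |∑ i, g (t - stdNormalCDF (x i))|
      ≤ 1 / (n : ℝ) * ∑ _i : Fin n, K := by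
        gcongr
        exact (Finset.abs_sum_le_sum_abs _ _).trans
          (Finset.sum_le_sum fun i _ => hK _ (stdNormalCDF_mem_Icc _))
    _ ≤ K := by
        rw [Finset.sum_const, Finset.card_univ, Fintype.card_fin, nsmul_eq_mul, ← mul_assoc]
        refine mul_le_of_le_one_left hK0 ?_
        rw [one_div]
        exact inv_mul_le_one

theorem integrable_smoothEmpirical {n : ℕ} {g : ℝ → ℝ} (hg : Continuous g) (t : ℝ)
    (μ : Measure (EuclideanSpace ℝ (Fin n))) [IsFiniteMeasure μ] :
    Integrable (fun x => smoothEmpirical g x t) μ := by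
  obtain ⟨K, hK⟩ := (isCompact_Icc (a := (0 : ℝ)) (b := 1)).exists_bound_of_continuousOn
    (f := fun y => g (t - y)) (by fun_prop)
  have hK0 : 0 ≤ K := (norm_nonneg _).trans (hK 0 (by simp))
  refine Integrable.of_bound
    ((continuous_smoothEmpirical hg).comp (Continuous.prodMk_left t)).aestronglyMeasurable K
    (ae_of_all _ fun x => abs_smoothEmpirical_le x hK hK0)

/-! ### Mean and variance of the smoothed process. -/

section GaussianVector

variable {n : ℕ} {C : Matrix (Fin n) (Fin n) ℝ}

theorem integral_smoothEmpirical (hn : 0 < n) (hC : C.PosSemidef) (hdiag : ∀ i, C i i = 1)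
    {g : ℝ → ℝ} (hg : Continuous g) (t : ℝ) :
    ∫ x, smoothEmpirical g x t ∂multivariateGaussian 0 C = ∫ y in (0 : ℝ)..1, g (t - y) := by
  have hΦ := continuous_stdNormalCDF
  have hev (i : Fin n) : ∫ x, g (t - stdNormalCDF (x i)) ∂multivariateGaussian 0 C =
      ∫ y in (0 : ℝ)..1, g (t - y) := by
    rw [← integral_comp_stdNormalCDF (h := fun y => g (t - y)) (by fun_prop),
      ← (measurePreserving_eval_stdGaussianMarginal hC hdiag i).map_eq,
      integral_map (by fun_prop) (Continuous.aestronglyMeasurable (by fun_prop))]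
  have hint (i : Fin n) : Integrable (fun x : EuclideanSpace ℝ (Fin n) =>
      g (t - stdNormalCDF (x i))) (multivariateGaussian 0 C) := by
    obtain ⟨K, hK⟩ := (isCompact_Icc (a := (0 : ℝ)) (b := 1)).exists_bound_of_continuousOn
      (f := fun y => g (t - y)) (by fun_prop)
    exact Integrable.of_bound (Continuous.aestronglyMeasurable (by fun_prop)) K
      (ae_of_all _ fun x => hK _ (stdNormalCDF_mem_Icc _))
  unfold smoothEmpirical
  rw [integral_const_mul, integral_finsetSum _ fun i _ => hint i]
  simp only [hev]
  have : (n : ℝ) ≠ 0 := by positivity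
  simp
  field_simp

/-- Variance bound for the empirical mean of a function of the uniformised coordinates. -/
theorem integral_sq_smoothEmpirical_sub_le (hn : 0 < n) (hC : C.PosSemidef)
    (hdiag : ∀ i, C i i = 1) {g : ℝ → ℝ} (hg : Continuous g) (t : ℝ) :
    ∫ x, (smoothEmpirical g x t - ∫ y in (0 : ℝ)..1, g (t - y)) ^ 2 ∂multivariateGaussian 0 C ≤
      ((n : ℝ) + offDiagAbsSum C) / (n : ℝ) ^ 2 *
        ((∫ y in (0 : ℝ)..1, g (t - y) ^ 2) - (∫ y in (0 : ℝ)..1, g (t - y)) ^ 2) := by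
  have hΦ := continuous_stdNormalCDF
  set μ := multivariateGaussian 0 C
  have hn0 : (n : ℝ) ≠ 0 := by positivity
  obtain ⟨K, hK⟩ := (isCompact_Icc (a := (0 : ℝ)) (b := 1)).exists_bound_of_continuousOn
    (f := fun y => g (t - y)) (by fun_prop)
  set f : ℝ → ℝ := fun x => g (t - stdNormalCDF x) with hf
  have hfc : Continuous f := by fun_prop
  have hfK (x : ℝ) : ‖f x‖ ≤ K := hK _ (stdNormalCDF_mem_Icc _)
  have hfL : MemLp f 2 (gaussianReal 0 1) :=
    MemLp.of_bound hfc.aestronglyMeasurable K (ae_of_all _ hfK)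
  have hf1 : ∫ x, f x ∂gaussianReal 0 1 = ∫ y in (0 : ℝ)..1, g (t - y) :=
    integral_comp_stdNormalCDF (h := fun y => g (t - y)) (by fun_prop)
  have hf2 : ∫ x, f x ^ 2 ∂gaussianReal 0 1 = ∫ y in (0 : ℝ)..1, g (t - y) ^ 2 :=
    integral_comp_stdNormalCDF (h := fun y => g (t - y) ^ 2) (by fun_prop)
  have hcov (i j : Fin n) := abs_integral_eval_mul_eval_sub_le hC hdiag i j hfL
  simp only [hf1, hf2] at hcov
  set m := ∫ y in (0 : ℝ)..1, g (t - y)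
  set V := (∫ y in (0 : ℝ)..1, g (t - y) ^ 2) - m ^ 2
  have hi1 := integrable_smoothEmpirical hg t μ
  have hi2 (i j : Fin n) : Integrable (fun x : EuclideanSpace ℝ (Fin n) => f (x i) * f (x j)) μ :=
    Integrable.of_bound (Continuous.aestronglyMeasurable (by fun_prop)) (K * K)
      (ae_of_all _ fun x => by
        rw [norm_mul]
        exact mul_le_mul (hfK _) (hfK _) (norm_nonneg _) ((norm_nonneg _).trans (hfK 0)))
  have hexpand (x : EuclideanSpace ℝ (Fin n)) : (smoothEmpirical g x t - m) ^ 2 =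
      1 / (n : ℝ) ^ 2 * ∑ i, ∑ j, f (x i) * f (x j) - 2 * m * smoothEmpirical g x t + m ^ 2 := by
    rw [← Finset.sum_mul_sum]
    simp only [smoothEmpirical, hf]
    field_simp
    ring
  have hint : ∫ x, (smoothEmpirical g x t - m) ^ 2 ∂μ =
      1 / (n : ℝ) ^ 2 * ∑ i, ∑ j, (∫ x, f (x i) * f (x j) ∂μ - m ^ 2) := by
    simp only [hexpand]
    have hd : Integrable (fun x : EuclideanSpace ℝ (Fin n) =>
        ∑ i, ∑ j, f (x i) * f (x j)) μ :=
      integrable_finsetSum _ fun i _ => integrable_finsetSum _ fun j _ => hi2 i j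
    have hs : Integrable (fun x : EuclideanSpace ℝ (Fin n) => 1 / (n : ℝ) ^ 2 *
        ∑ i, ∑ j, f (x i) * f (x j) - 2 * m * smoothEmpirical g x t) μ :=
      (hd.const_mul _).sub (hi1.const_mul _)
    rw [integral_add hs (integrable_const _),
      integral_sub (hd.const_mul _) (hi1.const_mul _), integral_const_mul, integral_const_mul,
      show ∫ x, smoothEmpirical g x t ∂μ = m from integral_smoothEmpirical hn hC hdiag hg t,
      integral_finsetSum _ fun i _ => integrable_finsetSum _ fun j _ => hi2 i j]
    simp only [integral_finsetSum Finset.univ fun j _ => hi2 _ j, Finset.sum_sub_distrib]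
    simp only [integral_const, probReal_univ, one_smul, Finset.sum_const, Finset.card_univ,
      Fintype.card_fin, nsmul_eq_mul]
    field_simp
    ring
  rw [hint, one_div_mul_eq_div, div_mul_eq_mul_div]
  refine div_le_div_of_nonneg_right ?_ (by positivity)
  calc ∑ i, ∑ j, (∫ x, f (x i) * f (x j) ∂μ - m ^ 2)
      ≤ ∑ i, ∑ j, |C i j| * V :=
        Finset.sum_le_sum fun i _ => Finset.sum_le_sum fun j _ => (le_abs_self _).trans (hcov i j)
    _ = (∑ p : Fin n × Fin n, |C p.1 p.2|) * V := by
        simp only [← Finset.sum_mul, Fintype.sum_prod_type]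
    -- The n diagonal pairs each contribute |C i i| = 1.
    _ = ((n : ℝ) + offDiagAbsSum C) * V := by
        rw [← Finset.univ_product_univ, ← Finset.diag_union_offDiag, Finset.sum_union
          (Finset.disjoint_diag_offDiag _), offDiagAbsSum]
        simp [hdiag]

end GaussianVector

/-! ### The process as a primitive of its derivative. -/

section Representation

variable {ℓ : ℝ → ℝ}

/-- Shifting the support by y in [0, 1] keeps it in [-1/2, 3/2], which lies inside (-1, 2]. This
confines the whole analysis to a window of length 3. -/
theorem deriv_sub_eq_zero (hsupp : Function.support (deriv ℓ) ⊆ Set.Icc (-(1 / 2)) (1 / 2))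
    {s y : ℝ} (hs : s ∉ Set.Ioc (-1 : ℝ) 2) (hy : y ∈ Set.Icc (0 : ℝ) 1) : deriv ℓ (s - y) = 0 := by
  by_contra h
  have h1 := hsupp h
  simp only [Set.mem_Icc, Set.mem_Ioc] at h1 hy hs
  exact hs ⟨by linarith [h1.1, hy.1], by linarith [h1.2, hy.2]⟩

theorem integral_deriv_sub (hℓ : ContDiff ℝ 1 ℓ)
    (hsupp : Function.support (deriv ℓ) ⊆ Set.Icc (-(1 / 2)) (1 / 2)) (t : ℝ) {y : ℝ}
    (hy : y ∈ Set.Icc (0 : ℝ) 1) : ∫ s in (-1 : ℝ)..t, deriv ℓ (s - y) = ℓ (t - y) - ℓ (-1) := by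
  have hg : Continuous (deriv ℓ) := hℓ.continuous_deriv le_rfl
  have hd (a b : ℝ) : ∫ s in a..b, deriv ℓ s = ℓ b - ℓ a :=
    intervalIntegral.integral_deriv_eq_sub
      (fun x _ => (hℓ.differentiable one_ne_zero).differentiableAt) (hg.intervalIntegrable _ _)
  rw [intervalIntegral.integral_comp_sub_right (deriv ℓ) y, hd]
  -- To the left of -1/2 the function `ℓ` is constant, so the starting value does not depend on y
  -- and cancels after centring.
  have h0 : ∫ s in (-1 - y)..(-1), deriv ℓ s = 0 := by
    rw [← intervalIntegral.integral_zero (a := -1 - y) (b := -1) (μ := volume)]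
    refine intervalIntegral.integral_congr fun s hs => ?_
    rw [Set.uIcc_of_le (by linarith [hy.1])] at hs
    by_contra h
    linarith [(hsupp h).1, hs.2]
  rw [hd] at h0
  linarith

/-- The centred smoothed empirical process is the primitive of its centred derivative. -/
theorem smoothEmpirical_sub_eq_integral {n : ℕ} (hn : 0 < n) (hℓ : ContDiff ℝ 1 ℓ)
    (hsupp : Function.support (deriv ℓ) ⊆ Set.Icc (-(1 / 2)) (1 / 2))
    (x : EuclideanSpace ℝ (Fin n)) (t : ℝ) :
    smoothEmpirical ℓ x t - ∫ y in (0 : ℝ)..1, ℓ (t - y) =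
      ∫ s in (-1 : ℝ)..t, (smoothEmpirical (deriv ℓ) x s - ∫ y in (0 : ℝ)..1, deriv ℓ (s - y)) := by
  have hg : Continuous (deriv ℓ) := hℓ.continuous_deriv le_rfl
  have hc := hℓ.continuous
  have hn0 : (n : ℝ) ≠ 0 := by positivity
  have h1 : ∫ s in (-1 : ℝ)..t, smoothEmpirical (deriv ℓ) x s = smoothEmpirical ℓ x t - ℓ (-1) := by
    unfold smoothEmpirical
    rw [intervalIntegral.integral_const_mul, intervalIntegral.integral_finsetSum
      fun i _ => Continuous.intervalIntegrable (by fun_prop) _ _]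
    simp only [integral_deriv_sub hℓ hsupp t (stdNormalCDF_mem_Icc _), Finset.sum_sub_distrib]
    simp
    field_simp
  have h2 : ∫ s in (-1 : ℝ)..t, ∫ y in (0 : ℝ)..1, deriv ℓ (s - y) =
      (∫ y in (0 : ℝ)..1, ℓ (t - y)) - ℓ (-1) := by
    have hswap : ∫ s in (-1 : ℝ)..t, ∫ y in (0 : ℝ)..1, deriv ℓ (s - y) =
        ∫ y in (0 : ℝ)..1, ∫ s in (-1 : ℝ)..t, deriv ℓ (s - y) := by
      simp only [intervalIntegral.integral_of_le zero_le_one]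
      refine intervalIntegral_integral_swap ?_
      rw [Measure.prod_restrict]
      refine (ContinuousOn.integrableOn_compact
        (isCompact_uIcc.prod (isCompact_Icc (a := (0 : ℝ)) (b := 1)))
        (Continuous.continuousOn ?_)).mono_set
          (Set.prod_mono Set.uIoc_subset_uIcc Set.Ioc_subset_Icc_self)
      simp only [Function.uncurry_def]
      fun_prop
    rw [hswap, intervalIntegral.integral_congr (g := fun y => ℓ (t - y) - ℓ (-1)),
      intervalIntegral.integral_sub (Continuous.intervalIntegrable (by fun_prop) _ _)
        (by simp)]
    · simp
    · intro y hy
      rw [Set.uIcc_of_le zero_le_one] at hy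
      exact integral_deriv_sub hℓ hsupp t hy
  rw [intervalIntegral.integral_sub, h1, h2]
  · ring
  · exact ((continuous_smoothEmpirical hg).comp (Continuous.prodMk_right x)).intervalIntegrable _ _
  · exact (continuous_intervalIntegral_sub hg).intervalIntegrable _ _

/-- A primitive of a function supported in an interval is bounded by its `L¹` norm there. -/
theorem abs_integral_le_of_eq_zero_off {w : ℝ → ℝ} (hw : Continuous w)
    (h0 : ∀ s ∉ Set.Ioc (-1 : ℝ) 2, w s = 0) (t : ℝ) :
    |∫ s in (-1 : ℝ)..t, w s| ≤ ∫ s in (-1 : ℝ)..2, |w s| := by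
  have hint : Integrable (fun s => |w s|) := by
    refine Continuous.integrable_of_hasCompactSupport (by fun_prop)
      (HasCompactSupport.of_support_subset_isCompact (isCompact_Icc (a := (-1 : ℝ)) (b := 2)) ?_)
    intro s hs
    by_contra h
    exact hs (by simp [h0 s fun h' => h (Set.Ioc_subset_Icc_self h')])
  rw [intervalIntegral.integral_of_le (by norm_num : (-1 : ℝ) ≤ 2),
    setIntegral_eq_integral_of_forall_compl_eq_zero fun s hs => by simp [h0 s hs]]
  -- The unordered interval also covers t < -1.
  calc |∫ s in (-1 : ℝ)..t, w s| ≤ ∫ s in Set.uIoc (-1 : ℝ) t, |w s| := by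
        simpa only [Real.norm_eq_abs] using
          intervalIntegral.norm_integral_le_integral_norm_uIoc (f := w) (μ := volume)
    _ ≤ ∫ s, |w s| := setIntegral_le_integral hint (ae_of_all _ fun s => abs_nonneg _)

end Representation

/-! ### Cauchy-Schwarz and the final estimate. -/

/-- Cauchy-Schwarz against the constant 1, obtained by integrating the square of |w| minus its
average A / M. -/
theorem sq_integral_abs_le {α : Type*} [MeasurableSpace α] {ν : Measure α} [IsFiniteMeasure ν]
    {w : α → ℝ} (hw : MemLp w 2 ν) :
    (∫ x, |w x| ∂ν) ^ 2 ≤ ν.real Set.univ * ∫ x, w x ^ 2 ∂ν := by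
  rcases eq_or_ne ν 0 with rfl | hν
  · simp
  have hpos : 0 < ν.real Set.univ := by
    rw [measureReal_def]
    exact ENNReal.toReal_pos (by simpa using hν) (measure_ne_top _ _)
  have h1 : Integrable (fun x => |w x|) ν := (hw.integrable (by norm_num)).abs
  have h2 : Integrable (fun x => w x ^ 2) ν := hw.integrable_sq
  set A := ∫ x, |w x| ∂ν
  set M := ν.real Set.univ
  have h : 0 ≤ ∫ x, (w x ^ 2 - 2 * (A / M) * |w x| + (A / M) ^ 2) ∂ν := by
    refine integral_nonneg fun x => ?_
    have : w x ^ 2 - 2 * (A / M) * |w x| + (A / M) ^ 2 = (|w x| - A / M) ^ 2 := by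
      rw [← sq_abs (w x)]; ring
    simp only [this, Pi.zero_apply]
    positivity
  have h3 : Integrable (fun x => w x ^ 2 - 2 * (A / M) * |w x|) ν := h2.sub (h1.const_mul _)
  rw [integral_add h3 (integrable_const _),
    integral_sub h2 (h1.const_mul _), integral_const_mul, integral_const, smul_eq_mul] at h
  change 0 ≤ _ - 2 * (A / M) * A + M * _ at h
  have e : M * ((∫ x, w x ^ 2 ∂ν) - 2 * (A / M) * A + M * (A / M) ^ 2) =
      M * (∫ x, w x ^ 2 ∂ν) - A ^ 2 := by
    field_simp
    ring
  nlinarith [mul_nonneg hpos.le h]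

theorem mainTheorem5 {Ω : Type*} [MeasurableSpace Ω] (P : Measure Ω) [IsProbabilityMeasure P]
    (n : ℕ) (hn : 0 < n) (C : Matrix (Fin n) (Fin n) ℝ) (hC : C.PosSemidef)
    (hdiag : ∀ i, C i i = 1)
    (X : Ω → EuclideanSpace ℝ (Fin n)) (hX : HasLaw X (multivariateGaussian 0 C) P)
    (ℓ : ℝ → ℝ) (hℓ : ContDiff ℝ 1 ℓ)
    (hsupp : Function.support (deriv ℓ) ⊆ Set.Icc (-(1 / 2)) (1 / 2)) :
    (∀ t : ℝ, Integrable (fun ω => smoothEmpirical ℓ (X ω) t) P) ∧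
    (∀ ω, BddAbove (Set.range fun t : ℝ =>
      |smoothEmpirical ℓ (X ω) t - ∫ ω', smoothEmpirical ℓ (X ω') t ∂P|)) ∧
    Integrable (fun ω => ⨆ t : ℝ,
      |smoothEmpirical ℓ (X ω) t - ∫ ω', smoothEmpirical ℓ (X ω') t ∂P|) P ∧
    ∫ ω, (⨆ t : ℝ,
      |smoothEmpirical ℓ (X ω) t - ∫ ω', smoothEmpirical ℓ (X ω') t ∂P|) ∂P
      ≤ (√6 + √3) * smoothingFunctional ℓ * √(((n : ℝ) + offDiagAbsSum C) / (n : ℝ) ^ 2) := by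
  have hg : Continuous (deriv ℓ) := hℓ.continuous_deriv le_rfl
  set μ := multivariateGaussian 0 C with hμ
  have hmean (t : ℝ) : ∫ ω', smoothEmpirical ℓ (X ω') t ∂P = ∫ y in (0 : ℝ)..1, ℓ (t - y) := by
    rw [← integral_smoothEmpirical hn hC hdiag hℓ.continuous t,
      ← hX.integral_comp (integrable_smoothEmpirical hℓ.continuous t _).aestronglyMeasurable]
    rfl
  simp only [hmean]
  let Z (x : EuclideanSpace ℝ (Fin n)) (t : ℝ) : ℝ :=
    smoothEmpirical ℓ x t - ∫ y in (0 : ℝ)..1, ℓ (t - y)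
  let W (x : EuclideanSpace ℝ (Fin n)) (s : ℝ) : ℝ :=
    smoothEmpirical (deriv ℓ) x s - ∫ y in (0 : ℝ)..1, deriv ℓ (s - y)
  have hWc : Continuous (Function.uncurry W) :=
    (continuous_smoothEmpirical hg).sub ((continuous_intervalIntegral_sub hg).comp continuous_snd)
  have hW0 (x) : ∀ s ∉ Set.Ioc (-1 : ℝ) 2, W x s = 0 := by
    intro s hs
    have h1 : smoothEmpirical (deriv ℓ) x s = 0 := by
      simp [smoothEmpirical, deriv_sub_eq_zero hsupp hs (stdNormalCDF_mem_Icc _)]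
    have h2 : ∫ y in (0 : ℝ)..1, deriv ℓ (s - y) = 0 := by
      refine (intervalIntegral.integral_congr (g := fun _ => (0 : ℝ)) fun y hy => ?_).trans
        (by simp)
      rw [Set.uIcc_of_le zero_le_one] at hy
      exact deriv_sub_eq_zero hsupp hs hy
    simp only [W, h1, h2, sub_zero]
  obtain ⟨K, hK⟩ : ∃ K, ∀ s, ‖deriv ℓ s‖ ≤ K :=
    (HasCompactSupport.of_support_subset_isCompact isCompact_Icc hsupp).exists_bound_of_continuous hg
  have hK0 : 0 ≤ K := (norm_nonneg _).trans (hK 0)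
  have hWK (x s) : |W x s| ≤ 2 * K := by
    have h1 := abs_smoothEmpirical_le (g := deriv ℓ) (t := s) x (fun y _ => hK _) hK0
    have h2 : |∫ y in (0 : ℝ)..1, deriv ℓ (s - y)| ≤ K := by
      simpa using intervalIntegral.norm_integral_le_of_norm_le_const (a := 0) (b := 1)
        (f := fun y => deriv ℓ (s - y)) fun y _ => hK _
    exact (abs_sub _ _).trans (by linarith)
  let J (x : EuclideanSpace ℝ (Fin n)) : ℝ := ∫ s in (-1 : ℝ)..2, |W x s|
  have hZJ (x t) : |Z x t| ≤ J x := by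
    simp only [Z, smoothEmpirical_sub_eq_integral hn hℓ hsupp]
    exact abs_integral_le_of_eq_zero_off (hWc.comp (Continuous.prodMk_right x)) (hW0 x) t
  have hJK (x) : J x ≤ 2 * K * 3 := by
    have h := intervalIntegral.norm_integral_le_of_norm_le_const (a := -1) (b := 2)
      (f := fun s => |W x s|) fun s _ => (by simpa using hWK x s : ‖|W x s|‖ ≤ 2 * K)
    norm_num at h
    exact (le_abs_self _).trans h
  have hbdd (x) : BddAbove (Set.range fun t => |Z x t|) :=
    ⟨J x, by rintro _ ⟨t, rfl⟩; exact hZJ x t⟩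
  let S (x : EuclideanSpace ℝ (Fin n)) : ℝ := ⨆ t, |Z x t|
  have hSJ (x) : S x ≤ J x := ciSup_le (hZJ x)
  have hS0 (x) : 0 ≤ S x := Real.iSup_nonneg fun t => abs_nonneg _
  have hSm : Measurable S := by
    have hZc : Continuous (Function.uncurry Z) :=
      (continuous_smoothEmpirical hℓ.continuous).sub
        ((continuous_intervalIntegral_sub hℓ.continuous).comp continuous_snd)
    obtain ⟨D, hDc, hDd⟩ := TopologicalSpace.exists_countable_dense ℝ
    have : Countable D := hDc.to_subtype
    -- Continuity in t reduces the supremum to a countable dense set, which gives measurability.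
    have : S = fun x => ⨆ t : D, |Z x t| := funext fun x =>
      (hDd.ciSup (hZc.comp (Continuous.prodMk_right x)).abs (hbdd x)).symm
    rw [this]
    exact Measurable.iSup fun t => (hZc.comp (Continuous.prodMk_left t.1)).abs.measurable
  have hSi : Integrable S μ := Integrable.of_bound hSm.aestronglyMeasurable (2 * K * 3)
    (ae_of_all _ fun x => by
      rw [Real.norm_eq_abs, abs_of_nonneg (hS0 x)]
      exact (hSJ x).trans (hJK x))
  have hmap {F : EuclideanSpace ℝ (Fin n) → ℝ} (hF : Integrable F μ) :
      Integrable (fun ω => F (X ω)) P := by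
    rw [← hX.map_eq] at hF
    exact hF.comp_aemeasurable hX.aemeasurable
  refine ⟨fun t => hmap (integrable_smoothEmpirical hℓ.continuous t μ), fun ω => hbdd (X ω),
    hmap hSi, ?_⟩
  change ∫ ω, S (X ω) ∂P ≤ _
  have hPS : ∫ ω, S (X ω) ∂P = ∫ x, S x ∂μ := hX.integral_comp hSm.aestronglyMeasurable
  rw [hPS]
  set lam : Measure ℝ := volume.restrict (Set.Ioc (-1) 2) with hlam
  have hWL : MemLp (Function.uncurry W) 2 (μ.prod lam) :=
    MemLp.of_bound hWc.aestronglyMeasurable (2 * K) (ae_of_all _ fun p => hWK p.1 p.2)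
  have hJint (x) : J x = ∫ s, |W x s| ∂lam :=
    intervalIntegral.integral_of_le (by norm_num)
  have hWi : Integrable (fun p : EuclideanSpace ℝ (Fin n) × ℝ => |W p.1 p.2|) (μ.prod lam) :=
    (hWL.integrable (by norm_num)).abs
  have hSA : ∫ x, S x ∂μ ≤ ∫ p, |W p.1 p.2| ∂(μ.prod lam) := by
    rw [integral_prod _ hWi]
    refine integral_mono hSi hWi.integral_prod_left fun x => ?_
    exact (hSJ x).trans (hJint x).le
  -- The length of (-1, 2] is the source of √3.
  have hmass : (μ.prod lam).real Set.univ = 3 := by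
    rw [← Set.univ_prod_univ, measureReal_prod_prod]
    simp [hlam]
    norm_num
  have hCS := sq_integral_abs_le hWL
  rw [hmass] at hCS
  have hB : ∫ p, Function.uncurry W p ^ 2 ∂(μ.prod lam) ≤
      ((n : ℝ) + offDiagAbsSum C) / (n : ℝ) ^ 2 * smoothingFunctional ℓ ^ 2 := by
    let V (t : ℝ) : ℝ := (∫ y in (0 : ℝ)..1, deriv ℓ (t - y) ^ 2) -
      (∫ y in (0 : ℝ)..1, deriv ℓ (t - y)) ^ 2
    have hVc : Continuous V :=
      (continuous_intervalIntegral_sub (g := fun y => deriv ℓ y ^ 2) (by fun_prop)).sub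
        ((continuous_intervalIntegral_sub hg).pow 2)
    have hle : ∫ p, Function.uncurry W p ^ 2 ∂(μ.prod lam) ≤
        ((n : ℝ) + offDiagAbsSum C) / (n : ℝ) ^ 2 * ∫ t in (-1 : ℝ)..2, V t := by
      have hi : Integrable (fun p : EuclideanSpace ℝ (Fin n) × ℝ => W p.1 p.2 ^ 2)
        (μ.prod lam) := hWL.integrable_sq
      calc ∫ p, Function.uncurry W p ^ 2 ∂(μ.prod lam)
          = ∫ s, ∫ x, W x s ^ 2 ∂μ ∂lam := integral_prod_symm _ hi
        _ ≤ ∫ s, ((n : ℝ) + offDiagAbsSum C) / (n : ℝ) ^ 2 * V s ∂lam := by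
            refine integral_mono hi.integral_prod_right ?_ fun s =>
              integral_sq_smoothEmpirical_sub_le hn hC hdiag hg s
            refine Integrable.const_mul ?_ _
            exact (hVc.integrableOn_Icc (a := -1) (b := 2)).mono_set Set.Ioc_subset_Icc_self
        _ = _ := by
            rw [integral_const_mul, intervalIntegral.integral_of_le (by norm_num)]
    refine hle.trans ?_
    have hoff : 0 ≤ offDiagAbsSum C := Finset.sum_nonneg fun _ _ => abs_nonneg _
    refine mul_le_mul_of_nonneg_left ?_ (by positivity)
    rw [smoothingFunctional]
    -- `Real.sqrt` is 0 on negative numbers, so this case split avoids proving that the integral of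
    -- `V` is nonnegative.
    rcases le_total 0 (∫ t in (-1 : ℝ)..2, V t) with h | h
    · exact (Real.sq_sqrt h).ge
    · exact h.trans (sq_nonneg _)
  have hD : 0 ≤ smoothingFunctional ℓ := Real.sqrt_nonneg _
  have hoff : 0 ≤ offDiagAbsSum C := Finset.sum_nonneg fun _ _ => abs_nonneg _
  calc ∫ x, S x ∂μ ≤ ∫ p, |W p.1 p.2| ∂(μ.prod lam) := hSA
    _ ≤ √3 * smoothingFunctional ℓ * √(((n : ℝ) + offDiagAbsSum C) / (n : ℝ) ^ 2) := by
        refine abs_le_of_sq_le_sq' ?_ (by positivity) |>.2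
        rw [mul_pow, mul_pow, Real.sq_sqrt (by norm_num), Real.sq_sqrt (by positivity)]
        refine hCS.trans ?_
        linarith
    -- The bound already holds with √3; adding √6 only weakens it.
    _ ≤ _ := by
        gcongr
        exact le_add_of_nonneg_left (Real.sqrt_nonneg _)
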